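/- Let $H$ be a complex separable Hilbert space, $\rho>1$, $\alpha\in(0,1)$ and $A\in L(H)$, where $L(X)$ denotes the bounded linear operators on $X$. Let $$\ell_{2,\rho}(\mathbb Z;H)=\Big\{x\in H^{\mathbb Z} : \|x\|^2=\sum_{k\in\mathbb Z}\|x_k\|_H^2\,\rho^{-2k}<\infty\Big\},$$ let $\tau\colon (x_k)_k\mapsto (x_{k+1})_k$ be the (bounded, boundedly invertible) left shift on $\ell_{2,\rho}(\mathbb Z;H)$, let $A$ act on $\ell_{2,\rho}(\mathbb Z;H)$ by $(x_k)_k\mapsto(Ax_k)_k$, and let $$(1-\tau^{-1})^\alpha=\sum_{k=0}^\infty \binom{\alpha}{k}(-\tau^{-1})^k ,\qquad\text{i.e.}\qquad \big((1-\tau^{-1})^\alpha u\big)_n=\sum_{k=0}^\infty(-1)^k\binom{\alpha}{k}u_{n-k}\quad(n\in\mathbb Z).$$ For $z\in\mathbb C$ with $|z|>1$ let $f(z)=z(1-z^{-1})^\alpha$, where $(1-z^{-1})^\alpha=\sum_{k=0}^\infty\binom{\alpha}{k}(-z^{-1})^k$. For $u\in H^{\mathbb Z}$ put $\operatorname{spt}u=\{n\in\mathbb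 Z:u_n\neq0\}$; for $x\in H$ let $\delta_{-1}x$ be the sequence with value $x$ at $-1$ and $0$ elsewhere. A linear operator $B$ on $\ell_{2,\rho}(\mathbb Z;H)$ is called causal if for all $a\in\mathbb Z$ and $u\in\ell_{2,\rho}(\mathbb Z;H)$, $\operatorname{spt}u\subseteq\mathbb Z_{\ge a}$ implies $\operatorname{spt}Bu\subseteq\mathbb Z_{\ge a}$. Then the following are equivalent: (i) $\tau(1-\tau^{-1})^\alpha-A$ has an inverse in $L(\ell_{2,\rho}(\mathbb Z;H))$, and this inverse is causal; (ii) $\tau(1-\tau^{-1})^\alpha-A$ has an inverse in $L(\ell_{2,\rho}(\mathbb Z;H))$, and for all $x\in H$, $\operatorname{spt}\,(\tau(1-\tau^{-1})^\alpha-A)^{-1}\delta_{-1}x\subseteq\mathbb N=\{0,1,2,\dots\}$; (iii) for all $\mu\ge\rho$, $\{f(z):z\in\mathbb C,\ |z|=\mu\}\cap\sigma(A)=\emptyset$, where $\sigma(A)$ is the spectrum of $A$. -/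

import Mathlib

noncomputable section

namespace FracDiff

/-! ### The binomial series -/

/-- The binomial power series `(1 + x) ^ α = ∑ₖ (α choose k) xᵏ`, in a complex topological algebra.
It is used for complex numbers and for bounded operators. -/
def onePlusPow {R : Type*} [Ring R] [Algebra ℂ R] [TopologicalSpace R] (α : ℂ) (x : R) : R :=
  ∑' k : ℕ, Ring.choose α k • x ^ k

theorem summable_norm_choose_mul_pow (α : ℂ) {r : ℝ} (h0 : 0 ≤ r) (h1 : r < 1) :
    Summable fun k : ℕ => ‖Ring.choose α k‖ * r ^ k := by
  lift r to NNReal using h0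
  have h := (binomialSeries ℂ α).summable_norm_mul_pow (r := r)
    (lt_of_lt_of_le (by exact_mod_cast h1) binomialSeries_radius_ge_one)
  simpa only [binomialSeries, FormalMultilinearSeries.ofScalars_norm] using h

/-- In a Banach algebra the binomial series converges absolutely on the open unit ball. -/
theorem hasSum_onePlusPow {R : Type*} [NormedRing R] [NormedAlgebra ℂ R] [CompleteSpace R]
    (α : ℂ) {x : R} (hx : ‖x‖ < 1) :
    HasSum (fun k : ℕ => Ring.choose α k • x ^ k) (onePlusPow α x) := by
  refine Summable.hasSum (Summable.of_norm_bounded_eventually_nat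
    (summable_norm_choose_mul_pow α (norm_nonneg x) hx) ?_)
  filter_upwards [Filter.eventually_ge_atTop 1] with k hk
  exact (norm_smul_le _ _).trans
    (mul_le_mul_of_nonneg_left (norm_pow_le' x hk) (norm_nonneg _))

/-- For complex numbers the binomial series is the principal branch of the power. -/
theorem onePlusPow_eq_cpow (α : ℂ) {z : ℂ} (hz : ‖z‖ < 1) :
    onePlusPow α z = (1 + z) ^ α := by
  have h := (Complex.one_add_cpow_hasFPowerSeriesOnBall_zero (a := α)).hasSum (y := z)
    (by rw [← ENNReal.ofReal_one, Metric.eball_ofReal]; simpa using hz)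
  have h2 := hasSum_onePlusPow α hz
  refine h2.unique ?_
  simpa [-FormalMultilinearSeries.apply_eq_prod_smul_coeff, binomialSeries_apply] using h

/-- The function `f(z) = z (1 - z⁻¹) ^ α`, for `1 < |z|`. -/
def symbol (α : ℂ) (z : ℂ) : ℂ := z * onePlusPow α (-z⁻¹)

/-! ### The weighted sequence space `ℓ_{2,ρ}(ℤ; H)` -/

section Space

variable (H : Type*) [NormedAddCommGroup H] [InnerProductSpace ℂ H]

/-- The sequence `k ↦ ρ⁻ᵏ xₖ`, as a linear map. -/
def rescale (ρ : ℝ) : (ℤ → H) →ₗ[ℂ] (ℤ → H) where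
  toFun x k := ((ρ : ℂ) ^ (-k)) • x k
  map_add' x y := by ext k; simp
  map_smul' c x := by
    ext k
    exact smul_comm _ _ _

variable {H} in
theorem norm_rescale_sq {ρ : ℝ} (hρ : 0 < ρ) (x : ℤ → H) (k : ℤ) :
    ‖rescale H ρ x k‖ ^ 2 = ‖x k‖ ^ 2 * ρ ^ (-2 * k) := by
  simp only [rescale, LinearMap.coe_mk, AddHom.coe_mk, norm_smul, norm_zpow, Complex.norm_real,
    Real.norm_of_nonneg hρ.le, mul_pow]
  rw [mul_comm, ← zpow_natCast (ρ ^ (-k)), ← zpow_mul]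
  congr 2
  push_cast
  ring

variable {H} in
theorem memlp_rescale_iff {ρ : ℝ} (hρ : 0 < ρ) (x : ℤ → H) :
    Memℓp (rescale H ρ x) 2 ↔ Summable fun k : ℤ => ‖x k‖ ^ 2 * ρ ^ (-2 * k) := by
  rw [memℓp_gen_iff (by norm_num)]
  simp only [ENNReal.toReal_ofNat, Real.rpow_two, norm_rescale_sq hρ]

/-- The sequences `x : ℤ → H` with `∑ₖ ‖xₖ‖² ρ^(-2k) < ∞`. -/
def weightedSubmodule (ρ : ℝ) [hρ : Fact (0 < ρ)] : Submodule ℂ (ℤ → H) where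
  carrier := {x | Summable fun k : ℤ => ‖x k‖ ^ 2 * ρ ^ (-2 * k)}
  zero_mem' := by simp [summable_zero]
  add_mem' {x y} hx hy := by
    simp only [Set.mem_ofPred_eq, ← memlp_rescale_iff hρ.out, map_add] at hx hy ⊢
    exact hx.add hy
  smul_mem' c x hx := by
    simp only [Set.mem_ofPred_eq, ← memlp_rescale_iff hρ.out, map_smul] at hx ⊢
    exact hx.const_smul c

/-- The weighted sequence space `ℓ_{2,ρ}(ℤ; H)`. It is a type of its own, so that it does not
inherit the product topology of `ℤ → H`. -/
def WeightedL2 (ρ : ℝ) [Fact (0 < ρ)] : Type _ := weightedSubmodule H ρ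

end Space

namespace WeightedL2

variable {H : Type*} [NormedAddCommGroup H] [InnerProductSpace ℂ H] {ρ : ℝ} [hρ : Fact (0 < ρ)]

instance : AddCommGroup (WeightedL2 H ρ) := inferInstanceAs (AddCommGroup (weightedSubmodule H ρ))
instance : Module ℂ (WeightedL2 H ρ) := inferInstanceAs (Module ℂ (weightedSubmodule H ρ))
instance : FunLike (WeightedL2 H ρ) ℤ H := ⟨fun x => x.1, Subtype.val_injective⟩

/-- A square summable (with weight) sequence as an element of the space. -/
def mk (x : ℤ → H) (hx : Summable fun k : ℤ => ‖x k‖ ^ 2 * ρ ^ (-2 * k)) : WeightedL2 H ρ := ⟨x, hx⟩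

@[simp] theorem mk_apply (x : ℤ → H) (hx : Summable fun k : ℤ => ‖x k‖ ^ 2 * ρ ^ (-2 * k))
    (k : ℤ) : (mk x hx : WeightedL2 H ρ) k = x k := rfl
@[simp] theorem add_apply (x y : WeightedL2 H ρ) (k : ℤ) : (x + y) k = x k + y k := rfl
@[simp] theorem smul_apply (c : ℂ) (x : WeightedL2 H ρ) (k : ℤ) : (c • x) k = c • x k := rfl
@[simp] theorem zero_apply (k : ℤ) : (0 : WeightedL2 H ρ) k = 0 := rfl

@[ext] theorem ext {x y : WeightedL2 H ρ} (h : ∀ k : ℤ, x k = y k) : x = y := DFunLike.ext x y h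

theorem summable (x : WeightedL2 H ρ) : Summable fun k : ℤ => ‖x k‖ ^ 2 * ρ ^ (-2 * k) := x.2

/-- `‖x‖ = (∑ₖ ‖xₖ‖² ρ^(-2k))^(1/2)`. -/
instance : Norm (WeightedL2 H ρ) := ⟨fun x : WeightedL2 H ρ => √(∑' k : ℤ, ‖x k‖ ^ 2 * ρ ^ (-2 * k))⟩

theorem norm_def (x : WeightedL2 H ρ) : ‖x‖ = √(∑' k : ℤ, ‖x k‖ ^ 2 * ρ ^ (-2 * k)) := rfl

theorem norm_sq (x : WeightedL2 H ρ) : ‖x‖ ^ 2 = ∑' k : ℤ, ‖x k‖ ^ 2 * ρ ^ (-2 * k) :=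
  Real.sq_sqrt (tsum_nonneg fun k => mul_nonneg (sq_nonneg _) (zpow_nonneg hρ.out.le _))

/-- The isomorphism `x ↦ (ρ⁻ᵏ xₖ)ₖ` onto the unweighted space. -/
def equivLp : WeightedL2 H ρ ≃ₗ[ℂ] lp (fun _ : ℤ => H) 2 where
  toFun x := ⟨rescale H ρ x, (memlp_rescale_iff hρ.out _).2 x.2⟩
  map_add' x y := Subtype.ext (map_add (rescale H ρ) x.1 y.1)
  map_smul' c x := Subtype.ext (map_smul (rescale H ρ) c x.1)
  invFun y := mk (fun k => ((ρ : ℂ) ^ k) • y k) <| by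
    have hρ' : (ρ : ℂ) ≠ 0 := by exact_mod_cast hρ.out.ne'
    rw [← memlp_rescale_iff hρ.out]
    have h : rescale H ρ (fun k => ((ρ : ℂ) ^ k) • y k) = y := by
      ext k
      simp [rescale, smul_smul, inv_mul_cancel₀ (zpow_ne_zero k hρ')]
    rw [h]
    exact lp.memℓp y
  left_inv x := by
    have hρ' : (ρ : ℂ) ≠ 0 := by exact_mod_cast hρ.out.ne'
    ext k
    change (ρ : ℂ) ^ k • (ρ : ℂ) ^ (-k) • x k = x k
    simp [smul_smul, mul_inv_cancel₀ (zpow_ne_zero k hρ')]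
  right_inv y := by
    have hρ' : (ρ : ℂ) ≠ 0 := by exact_mod_cast hρ.out.ne'
    ext k
    change (ρ : ℂ) ^ (-k) • (ρ : ℂ) ^ k • y k = y k
    simp [smul_smul, inv_mul_cancel₀ (zpow_ne_zero k hρ')]

theorem norm_equivLp (x : WeightedL2 H ρ) : ‖equivLp x‖ = ‖x‖ := by
  rw [lp.norm_eq_tsum_rpow (by norm_num), norm_def, Real.sqrt_eq_rpow]
  simp only [ENNReal.toReal_ofNat, Real.rpow_two]
  congr 1
  exact tsum_congr fun k => norm_rescale_sq hρ.out x k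

theorem core : NormedSpace.Core ℂ (WeightedL2 H ρ) where
  norm_nonneg x := by rw [← norm_equivLp]; exact norm_nonneg _
  norm_smul c x := by rw [← norm_equivLp, ← norm_equivLp, map_smul, norm_smul]
  norm_triangle x y := by
    rw [← norm_equivLp, ← norm_equivLp, ← norm_equivLp, map_add]; exact norm_add_le _ _
  norm_eq_zero_iff x := by rw [← norm_equivLp, norm_eq_zero, LinearEquiv.map_eq_zero_iff]

instance : NormedAddCommGroup (WeightedL2 H ρ) := NormedAddCommGroup.ofCore core
instance : NormedSpace ℂ (WeightedL2 H ρ) := NormedSpace.ofCore core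

instance [CompleteSpace H] : CompleteSpace (WeightedL2 H ρ) :=
  have e : WeightedL2 H ρ ≃ₗᵢ[ℂ] lp (fun _ : ℤ => H) 2 := ⟨equivLp, norm_equivLp⟩
  e.symm.isometry.isUniformInducing.completeSpace_congr e.symm.surjective |>.1 inferInstance

theorem norm_apply_le (x : WeightedL2 H ρ) (k : ℤ) : ‖x k‖ ≤ ρ ^ k * ‖x‖ := by
  have h := lp.norm_apply_le_norm (by norm_num) (equivLp x) k
  rw [norm_equivLp] at h
  have h2 : ‖(equivLp x) k‖ = ρ ^ (-k) * ‖x k‖ := by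
    change ‖((ρ : ℂ) ^ (-k)) • x k‖ = _
    rw [norm_smul, norm_zpow, Complex.norm_real, Real.norm_of_nonneg hρ.out.le]
  rw [h2, zpow_neg, inv_mul_le_iff₀ (zpow_pos hρ.out k)] at h
  exact h

/-- Evaluation at `k`, as a bounded operator. -/
def eval (k : ℤ) : WeightedL2 H ρ →L[ℂ] H :=
  LinearMap.mkContinuous
    { toFun := fun x => x k
      map_add' := fun _ _ => rfl
      map_smul' := fun _ _ => rfl } (ρ ^ k) fun x => norm_apply_le x k

@[simp] theorem eval_apply (k : ℤ) (x : WeightedL2 H ρ) : eval k x = x k := rfl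

/-- The sequence `δₙ x` with value `x` at `n` and `0` elsewhere. -/
def delta (n : ℤ) (x : H) : WeightedL2 H ρ :=
  mk (Pi.single n x) <| summable_of_ne_finset_zero (s := {n}) fun k hk => by
    simp [Pi.single_eq_of_ne (Finset.notMem_singleton.1 hk)]

/-! ### Operators -/

theorem hasSum_shift (n : ℤ) (x : WeightedL2 H ρ) :
    HasSum (fun k : ℤ => ‖x (k + n)‖ ^ 2 * ρ ^ (-2 * k)) ((ρ ^ n * ‖x‖) ^ 2) := by
  have h := ((Equiv.addRight n).hasSum_iff.2 x.summable.hasSum).mul_left ((ρ ^ n) ^ 2)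
  rw [← norm_sq, ← mul_pow] at h
  refine h.congr_fun fun k => ?_
  change _ = (ρ ^ n) ^ 2 * (‖x (k + n)‖ ^ 2 * ρ ^ (-2 * (k + n)))
  rw [mul_left_comm, ← zpow_natCast (ρ ^ n), ← zpow_mul, ← zpow_add₀ hρ.out.ne']
  congr 2
  push_cast
  ring

/-- The sequence `k ↦ x (k + n)`. -/
def shiftLinear (n : ℤ) : WeightedL2 H ρ →ₗ[ℂ] WeightedL2 H ρ where
  toFun x := mk (fun k => x (k + n)) (hasSum_shift n x).summable
  map_add' _ _ := rfl
  map_smul' _ _ := rfl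

theorem norm_shiftLinear (n : ℤ) (x : WeightedL2 H ρ) : ‖shiftLinear n x‖ = ρ ^ n * ‖x‖ := by
  rw [norm_def]
  change √(∑' k : ℤ, ‖x (k + n)‖ ^ 2 * ρ ^ (-2 * k)) = _
  rw [(hasSum_shift n x).tsum_eq,
    Real.sqrt_sq (mul_nonneg (zpow_nonneg hρ.out.le _) (norm_nonneg _))]

variable (H ρ) in
/-- The left shift `τ : (xₖ)ₖ ↦ (xₖ₊₁)ₖ`, with its bounded inverse. -/
def shift : WeightedL2 H ρ ≃L[ℂ] WeightedL2 H ρ :=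
  LinearEquiv.toContinuousLinearEquivOfBounds
    { shiftLinear 1 with
      invFun := shiftLinear (-1)
      left_inv := fun x => by
        ext k
        change x (k + -1 + 1) = x k
        congr 1
        ring
      right_inv := fun x => by
        ext k
        change x (k + 1 + -1) = x k
        congr 1
        ring } (ρ ^ (1 : ℤ)) (ρ ^ (-1 : ℤ))
    (fun x => (norm_shiftLinear 1 x).le) (fun x => (norm_shiftLinear (-1) x).le)

@[simp] theorem shift_apply (x : WeightedL2 H ρ) (k : ℤ) : shift H ρ x k = x (k + 1) := rfl

@[simp] theorem shift_symm_apply (x : WeightedL2 H ρ) (k : ℤ) :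
    (shift H ρ).symm x k = x (k - 1) := rfl

/-- The operator `(xₖ)ₖ ↦ (A xₖ)ₖ` for a bounded operator `A` of `H`. -/
def pointwise (A : H →L[ℂ] H) : WeightedL2 H ρ →L[ℂ] WeightedL2 H ρ :=
  have le : ∀ (x : WeightedL2 H ρ) (k : ℤ),
      ‖A (x k)‖ ^ 2 * ρ ^ (-2 * k) ≤ ‖A‖ ^ 2 * (‖x k‖ ^ 2 * ρ ^ (-2 * k)) := fun x k => by
    rw [← mul_assoc, ← mul_pow]
    exact mul_le_mul_of_nonneg_right (pow_le_pow_left₀ (norm_nonneg _) (A.le_opNorm _) 2)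
      (zpow_nonneg hρ.out.le _)
  have nonneg : ∀ (x : WeightedL2 H ρ) (k : ℤ), 0 ≤ ‖A (x k)‖ ^ 2 * ρ ^ (-2 * k) := fun _ _ =>
    mul_nonneg (sq_nonneg _) (zpow_nonneg hρ.out.le _)
  have sum : ∀ x : WeightedL2 H ρ, Summable fun k : ℤ => ‖A (x k)‖ ^ 2 * ρ ^ (-2 * k) := fun x =>
    Summable.of_nonneg_of_le (nonneg x) (le x) (x.summable.mul_left _)
  LinearMap.mkContinuous
    { toFun := fun x => mk (fun k => A (x k)) (sum x)
      map_add' := fun x y => by ext k; exact map_add A _ _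
      map_smul' := fun c x => by ext k; exact map_smul A _ _ } ‖A‖ fun x => by
    refine le_of_sq_le_sq ?_ (mul_nonneg (norm_nonneg _) (norm_nonneg _))
    rw [mul_pow, norm_sq, norm_sq, ← tsum_mul_left]
    exact (sum x).tsum_le_tsum (le x) (x.summable.mul_left _)

@[simp] theorem pointwise_apply (A : H →L[ℂ] H) (x : WeightedL2 H ρ) (k : ℤ) :
    pointwise A x k = A (x k) := rfl

variable (H ρ) in
/-- The operator `(1 - τ⁻¹) ^ α`, by the binomial series at `-τ⁻¹`. -/
def fracPow (α : ℂ) : WeightedL2 H ρ →L[ℂ] WeightedL2 H ρ :=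
  onePlusPow α (-((shift H ρ).symm : WeightedL2 H ρ →L[ℂ] WeightedL2 H ρ))

theorem norm_shift_symm_lt_one (h1 : 1 < ρ) :
    ‖((shift H ρ).symm : WeightedL2 H ρ →L[ℂ] WeightedL2 H ρ)‖ < 1 := by
  refine lt_of_le_of_lt (ContinuousLinearMap.opNorm_le_bound _
    (zpow_nonneg hρ.out.le (-1)) fun x => (norm_shiftLinear (-1) x).le) ?_
  rw [zpow_neg_one]
  exact inv_lt_one_of_one_lt₀ h1

theorem neg_shift_symm_pow_apply (k : ℕ) (u : WeightedL2 H ρ) (n : ℤ) :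
    ((-((shift H ρ).symm : WeightedL2 H ρ →L[ℂ] WeightedL2 H ρ)) ^ k) u n
      = (-1 : ℂ) ^ k • u (n - k) := by
  induction k generalizing n with
  | zero => simp
  | succ k ih =>
    rw [pow_succ', mul_apply_eq_comp]
    change -(((-((shift H ρ).symm : WeightedL2 H ρ →L[ℂ] WeightedL2 H ρ)) ^ k) u (n - 1)) = _
    rw [ih, pow_succ, mul_neg_one, neg_smul]
    congr 3
    push_cast
    ring

/-- For `ρ > 1` the operator `(1 - τ⁻¹) ^ α` is the convolution with `(-1)ᵏ (α choose k)`. -/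
theorem hasSum_fracPow_apply [CompleteSpace H] (h1 : 1 < ρ) (α : ℂ) (u : WeightedL2 H ρ) (n : ℤ) :
    HasSum (fun k : ℕ => ((-1) ^ k * Ring.choose α k) • u (n - k)) (fracPow H ρ α u n) := by
  have h := hasSum_onePlusPow α
    (x := -((shift H ρ).symm : WeightedL2 H ρ →L[ℂ] WeightedL2 H ρ))
    (by rw [norm_neg]; exact norm_shift_symm_lt_one h1)
  have h2 := ((ContinuousLinearMap.apply ℂ (WeightedL2 H ρ) u).hasSum h).mapL (eval n)
  refine h2.congr_fun fun k => ?_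
  change _ = Ring.choose α k •
    (((-((shift H ρ).symm : WeightedL2 H ρ →L[ℂ] WeightedL2 H ρ)) ^ k) u n)
  rw [neg_shift_symm_pow_apply, smul_smul, mul_comm]

/-- The operator `τ (1 - τ⁻¹) ^ α - A`. -/
def fracOp (α : ℂ) (A : H →L[ℂ] H) : WeightedL2 H ρ →L[ℂ] WeightedL2 H ρ :=
  (shift H ρ : WeightedL2 H ρ →L[ℂ] WeightedL2 H ρ) * fracPow H ρ α - pointwise A

/-- `B` is causal: if `f` is supported in `ℤ_{≥ a}`, then so is `B f`. -/
def IsCausal (B : WeightedL2 H ρ →ₗ[ℂ] WeightedL2 H ρ) : Prop :=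
  ∀ (a : ℤ) (f : WeightedL2 H ρ),
    Function.support f ⊆ Set.Ici a → Function.support (B f) ⊆ Set.Ici a

/-- `B` is the bounded two-sided inverse of `T`. -/
def IsInverse (T B : WeightedL2 H ρ →L[ℂ] WeightedL2 H ρ) : Prop := T * B = 1 ∧ B * T = 1

end WeightedL2

end FracDiff

end

/-!
Write `T = τ (1 - τ⁻¹) ^ α - A` and `f` for `symbol α`. On geometric sequences `(zᵏ x)ₖ` the
operator `T` acts as `f(z) - A`, and everything rests on this correspondence.

Causality of `B = T⁻¹` puts the support of `u = B δ₋₁ x` into `{-1, 0, 1, …}`, and since the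
coefficient of `τ` in `T` is `1`, comparing `T u = δ₋₁ x` at the index `-2` gives `u₋₁ = 0`
(`support_delta_subset_of_isCausal`).

If `B = T⁻¹` maps `δ₋₁ x` into sequences supported in `ℕ`, let `1 < ρ < |z|` and apply `B` to the
half-geometric sequence `v = (zᵏ y)_{k ≤ 0}`, which lies in the space. As `τ v = z v - z δ₀ y` and
`B` commutes with `τ`, the sequence `w = B v` satisfies `w_{k+1} = z w_k` for `k ≤ 0`. So `w` is
geometric up to the index `1`, and `T w = v` at the index `0` says `(f(z) - A) w₀ = y`. The map
`y ↦ w₀` commutes with `A`, hence is the resolvent of `A` at `f(z)`, and comparing the norms of the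
half-geometric sequences of `y` and `w₀` gives `‖w₀‖ ≤ ‖B‖ ‖y‖`
(`resolventMap`, `norm_resolventMap_apply_le`). The bound does not depend on `z`, so `f(z) - A`
stays invertible in the limit `|z| → ρ` (`symbol_notMem_spectrum`).

Conversely, `T = τ U` with `U = (1 - τ⁻¹) ^ α - τ⁻¹ A`. The causal operators in the double
commutant of `{τ⁻¹, A}` form a commutative Banach algebra. A character `χ` of it takes `τ⁻¹` to
some `w` with `|w| ≤ ρ⁻¹` and `A` to some `λ ∈ σ(A)`, because the resolvents of `A` belong to the
algebra. Thus `χ(U) = (1 - w) ^ α - w λ`, which is `1` for `w = 0` and `w (f(w⁻¹) - λ)` otherwise.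
If `σ(A)` misses the values `f(z)`, `|z| ≥ ρ`, no character annihilates `U`, so by Gelfand theory
`U` has an inverse in the algebra, which is therefore causal (`exists_isInverse_isCausal`).
-/

noncomputable section

namespace FracDiff

/-! ### The binomial series and characters -/

/-- Continuous algebra homomorphisms commute with the binomial series. -/
theorem map_onePlusPow {R S : Type*} [NormedRing R] [NormedAlgebra ℂ R] [CompleteSpace R]
    [NormedRing S] [NormedAlgebra ℂ S] (φ : R →ₐ[ℂ] S) (hφ : Continuous φ) (α : ℂ) {x : R}
    (hx : ‖x‖ < 1) : φ (onePlusPow α x) = onePlusPow α (φ x) := by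
  have h := (hasSum_onePlusPow α hx).map φ hφ
  refine (h.tsum_eq.symm.trans ?_)
  simp only [onePlusPow, Function.comp_def, map_smul, map_pow]

theorem hasSum_symbol (α : ℂ) {z : ℂ} (hz : 1 < ‖z‖) :
    HasSum (fun k : ℕ => (-1) ^ k * Ring.choose α k * z ^ (1 - (k : ℤ))) (symbol α z) := by
  have hz0 : z ≠ 0 := norm_pos_iff.1 (zero_lt_one.trans hz)
  have h := (hasSum_onePlusPow α (x := -z⁻¹)
    (by rw [norm_neg, norm_inv]; exact inv_lt_one_of_one_lt₀ hz)).mul_left z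
  refine h.congr_fun fun k => ?_
  rw [zpow_sub₀ hz0, zpow_one, zpow_natCast, neg_pow z⁻¹, inv_pow, smul_eq_mul, div_eq_mul_inv]
  ring

theorem continuousAt_symbol (α : ℂ) {z : ℂ} (hz : 1 < ‖z‖) : ContinuousAt (symbol α) z := by
  have hz0 : z ≠ 0 := norm_pos_iff.1 (zero_lt_one.trans hz)
  have hlt : ∀ w : ℂ, 1 < ‖w‖ → ‖-w⁻¹‖ < 1 := fun w hw => by
    rw [norm_neg, norm_inv]; exact inv_lt_one_of_one_lt₀ hw
  have heq : symbol α =ᶠ[nhds z] fun w => w * (1 + -w⁻¹) ^ α := by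
    filter_upwards [(isOpen_lt continuous_const continuous_norm).mem_nhds hz] with w hw
    rw [symbol, onePlusPow_eq_cpow α (hlt w hw)]
  refine ContinuousAt.congr ?_ heq.symm
  refine continuousAt_id.mul (ContinuousAt.cpow ?_ continuousAt_const ?_)
  · exact continuousAt_const.add (continuousAt_inv₀ hz0).neg
  · exact Complex.mem_slitPlane_of_norm_lt_one (hlt z hz)

/-- Gelfand's criterion for invertibility in a closed commutative subalgebra of a Banach algebra. -/
theorem isUnit_of_forall_algHom_ne_zero {R : Type*} [NormedRing R] [NormedAlgebra ℂ R]
    [CompleteSpace R] (D : Subalgebra ℂ R) (hD : IsClosed (D : Set R))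
    (hcomm : ∀ x y : D, x * y = y * x) (a : D)
    (h : ∀ χ : D →ₐ[ℂ] ℂ, (∀ x, ‖χ x‖ ≤ ‖x‖ * ‖(1 : D)‖) → χ a ≠ 0) : IsUnit a := by
  let _ : NormedCommRing D := { Subalgebra.normedRing D with mul_comm := hcomm }
  have : CompleteSpace D := hD.completeSpace_coe
  by_contra ha
  obtain ⟨χ, hχ⟩ := WeakDual.CharacterSpace.exists_apply_eq_zero ha
  refine h (WeakDual.CharacterSpace.toAlgHom χ) (fun x => ?_) hχ
  exact spectrum.norm_le_norm_mul_of_mem (AlgHom.apply_mem_spectrum _ x)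

namespace WeightedL2

variable {H : Type*} [NormedAddCommGroup H] [InnerProductSpace ℂ H] {ρ : ℝ} [hρ : Fact (0 < ρ)]

/-! ### The operator and its commutants -/

@[simp] theorem sub_apply (x y : WeightedL2 H ρ) (k : ℤ) : (x - y) k = x k - y k := rfl

theorem delta_apply_of_ne {n k : ℤ} (h : k ≠ n) (x : H) : (delta n x : WeightedL2 H ρ) k = 0 :=
  Pi.single_eq_of_ne (M := fun _ : ℤ => H) h x

theorem norm_le_norm_of_forall_le {x y : WeightedL2 H ρ} (h : ∀ k, ‖x k‖ ≤ ‖y k‖) :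
    ‖x‖ ≤ ‖y‖ := by
  rw [norm_def, norm_def]
  refine Real.sqrt_le_sqrt (x.summable.tsum_le_tsum (fun k => ?_) y.summable)
  exact mul_le_mul_of_nonneg_right (pow_le_pow_left₀ (norm_nonneg _) (h k) 2)
    (zpow_nonneg hρ.out.le _)

theorem fracOp_apply (α : ℂ) (A : H →L[ℂ] H) (u : WeightedL2 H ρ) (n : ℤ) :
    fracOp α A u n = fracPow H ρ α u (n + 1) - A (u n) := rfl

variable (H ρ) in
/-- The right shift `τ⁻¹` as a bounded operator. -/
abbrev backShift : WeightedL2 H ρ →L[ℂ] WeightedL2 H ρ :=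
  ((shift H ρ).symm : WeightedL2 H ρ →L[ℂ] WeightedL2 H ρ)

variable (H ρ) in
/-- The left shift `τ` as a bounded operator. -/
abbrev frontShift : WeightedL2 H ρ →L[ℂ] WeightedL2 H ρ :=
  (shift H ρ : WeightedL2 H ρ →L[ℂ] WeightedL2 H ρ)

theorem frontShift_mul_backShift : frontShift H ρ * backShift H ρ = 1 := by
  ext x k
  exact congrArg (fun y : WeightedL2 H ρ => y k) ((shift H ρ).apply_symm_apply x)

theorem backShift_mul_frontShift : backShift H ρ * frontShift H ρ = 1 := by
  ext x k
  exact congrArg (fun y : WeightedL2 H ρ => y k) ((shift H ρ).symm_apply_apply x)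

theorem norm_backShift_le : ‖backShift H ρ‖ ≤ ρ⁻¹ := by
  rw [← zpow_neg_one]
  exact ContinuousLinearMap.opNorm_le_bound _ (zpow_nonneg hρ.out.le (-1)) fun x =>
    (norm_shiftLinear (-1) x).le

theorem commute_frontShift_pointwise (A : H →L[ℂ] H) :
    Commute (frontShift H ρ) (pointwise A) :=
  ContinuousLinearMap.ext fun _ => WeightedL2.ext fun _ => rfl

theorem commute_backShift_pointwise (A : H →L[ℂ] H) :
    Commute (backShift H ρ) (pointwise A) :=
  ContinuousLinearMap.ext fun _ => WeightedL2.ext fun _ => rfl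

theorem commute_fracPow [CompleteSpace H] (h1 : 1 < ρ) (α : ℂ)
    {X : WeightedL2 H ρ →L[ℂ] WeightedL2 H ρ} (hX : Commute X (backShift H ρ)) :
    Commute X (fracPow H ρ α) := by
  have h := hasSum_onePlusPow α (x := -backShift H ρ)
    (by rw [norm_neg]; exact norm_shift_symm_lt_one h1)
  refine (h.mul_left X).unique (((h.mul_right X)).congr_fun fun k => ?_)
  exact ((hX.neg_right.pow_right k).smul_right _).eq

theorem commute_fracOp_frontShift [CompleteSpace H] (h1 : 1 < ρ) (α : ℂ) (A : H →L[ℂ] H) :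
    Commute (fracOp α A) (frontShift H ρ) := by
  have h : Commute (frontShift H ρ) (backShift H ρ) :=
    frontShift_mul_backShift.trans backShift_mul_frontShift.symm
  exact ((Commute.refl _).mul_left (commute_fracPow h1 α h).symm).sub_left
    (commute_frontShift_pointwise A).symm

theorem commute_fracOp_pointwise [CompleteSpace H] (h1 : 1 < ρ) (α : ℂ) (A : H →L[ℂ] H) :
    Commute (fracOp α A) (pointwise (ρ := ρ) A) :=
  ((commute_frontShift_pointwise A).mul_left
    (commute_fracPow h1 α (commute_backShift_pointwise A).symm).symm).sub_left (Commute.refl _)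

theorem IsInverse.commute {T B X : WeightedL2 H ρ →L[ℂ] WeightedL2 H ρ} (h : IsInverse T B)
    (hX : Commute T X) : Commute B X := by
  change B * X = X * B
  calc B * X = B * (X * T) * B := by rw [mul_assoc, mul_assoc, h.1, mul_one]
    _ = B * (T * X) * B := by rw [hX.eq]
    _ = X * B := by rw [← mul_assoc, h.2, one_mul]

/-! ### Causality of the inverse on `δ₋₁ x` -/

/-- The coefficient of `τ` in `T` is `1`, so at the first index of its support `u` agrees with
`T u` one index earlier. -/
theorem fracOp_apply_of_support_subset [CompleteSpace H] (h1 : 1 < ρ) (α : ℂ) (A : H →L[ℂ] H)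
    {u : WeightedL2 H ρ} {a : ℤ} (hu : Function.support u ⊆ Set.Ici (a + 1)) :
    fracOp α A u a = u (a + 1) := by
  have h0 : ∀ k, k ≤ a → u k = 0 := fun k hk => by
    by_contra hne
    have : a + 1 ≤ k := hu hne
    omega
  have h2 := hasSum_single (f := fun k : ℕ => ((-1) ^ k * Ring.choose α k) • u (a + 1 - k)) 0
    fun k hk => by rw [h0 _ (by omega), smul_zero]
  rw [fracOp_apply, h0 a le_rfl, map_zero, sub_zero,
    (hasSum_fracPow_apply h1 α u (a + 1)).unique h2]
  simp

theorem support_delta_subset_of_isCausal [CompleteSpace H] (h1 : 1 < ρ) (α : ℂ) {A : H →L[ℂ] H}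
    {B : WeightedL2 H ρ →L[ℂ] WeightedL2 H ρ} (hB : IsInverse (fracOp α A) B)
    (hc : IsCausal (B : WeightedL2 H ρ →ₗ[ℂ] WeightedL2 H ρ)) (x : H) :
    Function.support (B (delta (-1) x)) ⊆ Set.Ici (0 : ℤ) := by
  have hsupp : Function.support (B (delta (-1) x)) ⊆ Set.Ici (-2 + 1 : ℤ) := by
    refine hc (-1) (delta (-1) x) fun k hk => ?_
    by_contra hlt
    exact hk (delta_apply_of_ne (fun h => hlt h.ge) x)
  have h := fracOp_apply_of_support_subset h1 α A hsupp
  have hT : fracOp α A (B (delta (-1) x)) = delta (-1) x := DFunLike.congr_fun hB.1 _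
  rw [hT, delta_apply_of_ne (by norm_num)] at h
  intro k hk
  have hk1 : (-2 + 1 : ℤ) ≤ k := hsupp hk
  have hk2 : k ≠ -2 + 1 := fun he => hk (by rw [he, ← h])
  change 0 ≤ k
  omega

/-! ### Half-geometric sequences and the resolvent of `A` -/

theorem summable_halfGeometric {z : ℂ} (hz : ρ < ‖z‖) (y : H) :
    Summable fun k : ℤ => ‖if k ≤ 0 then z ^ k • y else 0‖ ^ 2 * ρ ^ (-2 * k) := by
  have hz0 : 0 < ‖z‖ := hρ.out.trans hz
  have hinj : Function.Injective fun n : ℕ => -(n : ℤ) := fun m n h => by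
    simpa using h
  refine (hinj.summable_iff fun k hk => ?_).1 ?_
  · have : ¬ k ≤ 0 := fun h => hk ⟨k.natAbs, by simp only; omega⟩
    simp [this]
  · have hq : (ρ / ‖z‖) ^ 2 < 1 :=
      pow_lt_one₀ (div_nonneg hρ.out.le hz0.le) ((div_lt_one hz0).2 hz) two_ne_zero
    refine ((summable_geometric_of_lt_one (sq_nonneg _) hq).mul_left (‖y‖ ^ 2)).congr fun n => ?_
    have hn : -(n : ℤ) ≤ 0 := by omega
    have e : (-2 * -(n : ℤ)) = ((2 * n : ℕ) : ℤ) := by push_cast; ring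
    simp only [Function.comp_apply, if_pos hn, norm_smul, e, zpow_neg, zpow_natCast, norm_inv,
      norm_pow]
    rw [div_pow, div_pow, ← pow_mul, ← pow_mul, mul_pow, inv_pow, ← pow_mul, mul_comm n 2]
    ring

/-- The sequence `(zᵏ y)_{k ≤ 0}`, continued by zero, as a linear function of `y`. It lies in
`ℓ_{2,ρ}` because `ρ < |z|`. -/
def halfGeometric {z : ℂ} (hz : ρ < ‖z‖) : H →ₗ[ℂ] WeightedL2 H ρ where
  toFun y := mk (fun k => if k ≤ 0 then z ^ k • y else 0) (summable_halfGeometric hz y)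
  map_add' x y := by
    ext k
    simp only [mk_apply, add_apply]
    split_ifs <;> simp
  map_smul' c x := by
    ext k
    simp only [mk_apply, smul_apply, RingHom.id_apply]
    split_ifs
    · exact smul_comm _ _ _
    · simp

theorem halfGeometric_apply {z : ℂ} (hz : ρ < ‖z‖) (y : H) (k : ℤ) :
    halfGeometric hz y k = if k ≤ 0 then z ^ k • y else 0 := rfl

theorem exists_norm_halfGeometric {z : ℂ} (hz : ρ < ‖z‖) :
    ∃ c : ℝ, 0 < c ∧ ∀ y : H, ‖halfGeometric hz y‖ = c * ‖y‖ := by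
  set g : ℤ → ℝ := fun k => ‖if k ≤ 0 then z ^ k • (1 : ℂ) else 0‖ ^ 2 * ρ ^ (-2 * k) with hg
  have hs : Summable g := summable_halfGeometric hz (1 : ℂ)
  have hg0 : ∀ k, 0 ≤ g k := fun k => mul_nonneg (sq_nonneg _) (zpow_nonneg hρ.out.le _)
  refine ⟨√(∑' k, g k), Real.sqrt_pos.2 (hs.tsum_pos hg0 0 (by simp [hg])), fun y => ?_⟩
  have hmul : √(∑' k, g k) * ‖y‖ = √(∑' k, g k * ‖y‖ ^ 2) := by
    rw [tsum_mul_right, Real.sqrt_mul (tsum_nonneg hg0), Real.sqrt_sq (norm_nonneg y)]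
  rw [norm_def, hmul]
  congr 1
  refine tsum_congr fun k => ?_
  simp only [halfGeometric_apply, hg]
  split_ifs
  · simp only [norm_smul, norm_one]
    ring
  · simp

theorem frontShift_halfGeometric {z : ℂ} (hz : ρ < ‖z‖) (y : H) :
    frontShift H ρ (halfGeometric hz y) = z • halfGeometric hz y - z • delta 0 y := by
  have hz0 : z ≠ 0 := norm_pos_iff.1 (hρ.out.trans hz)
  ext k
  change halfGeometric hz y (k + 1) = z • halfGeometric hz y k - z • (delta 0 y : WeightedL2 H ρ) k
  simp only [halfGeometric_apply]
  rcases lt_trichotomy k 0 with hk | rfl | hk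
  · rw [if_pos (by omega), if_pos hk.le, delta_apply_of_ne hk.ne, smul_zero, sub_zero, smul_smul,
      zpow_add_one₀ hz0, mul_comm]
  · simp [delta]
  · rw [if_neg (by omega), if_neg (by omega), delta_apply_of_ne hk.ne']
    simp

theorem frontShift_delta (n : ℤ) (y : H) :
    frontShift H ρ (delta (n + 1) y) = delta n y := by
  ext k
  change (delta (n + 1) y : WeightedL2 H ρ) (k + 1) = (delta n y : WeightedL2 H ρ) k
  rcases eq_or_ne k n with rfl | hk
  · simp [delta]
  · rw [delta_apply_of_ne hk, delta_apply_of_ne (by omega)]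

section Resolvent

/-- The map `y ↦ w₀` for `w = B v`, `v = (zᵏ y)_{k ≤ 0}`. -/
def resolventMap (B : WeightedL2 H ρ →L[ℂ] WeightedL2 H ρ) {z : ℂ} (hz : ρ < ‖z‖) : H →ₗ[ℂ] H :=
  ((eval 0 : WeightedL2 H ρ →L[ℂ] H) ∘L B).toLinearMap ∘ₗ halfGeometric hz

theorem resolventMap_apply (B : WeightedL2 H ρ →L[ℂ] WeightedL2 H ρ) {z : ℂ} (hz : ρ < ‖z‖)
    (y : H) :
    resolventMap B hz y = B (halfGeometric hz y) 0 := rfl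

variable [CompleteSpace H] {α : ℂ} {A : H →L[ℂ] H} {B : WeightedL2 H ρ →L[ℂ] WeightedL2 H ρ}
  {z : ℂ}

/-- The inverse of `T` maps a half-geometric sequence to one that is geometric up to the
index `1`. -/
theorem inverse_halfGeometric_apply (h1 : 1 < ρ) (hB : IsInverse (fracOp α A) B)
    (hδ : ∀ x : H, Function.support (B (delta (-1) x)) ⊆ Set.Ici (0 : ℤ)) (hz : ρ < ‖z‖) (y : H)
    (j : ℕ) : B (halfGeometric hz y) (1 - (j : ℤ)) = z ^ (1 - (j : ℤ)) • B (halfGeometric hz y) 0 := by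
  have hz0 : z ≠ 0 := norm_pos_iff.1 (hρ.out.trans hz)
  have hcomm : ∀ u : WeightedL2 H ρ, B (frontShift H ρ u) = frontShift H ρ (B u) := fun u =>
    DFunLike.congr_fun (hB.commute (commute_fracOp_frontShift h1 α A)).eq u
  have hδ0 : ∀ k : ℤ, k ≤ 0 → B (delta 0 y) k = 0 := fun k hk => by
    have h := congrArg (fun u : WeightedL2 H ρ => u (k - 1)) (hcomm (delta (-1 + 1) y))
    rw [frontShift_delta] at h
    change B (delta (-1) y) (k - 1) = B (delta 0 y) (k - 1 + 1) at h
    rw [sub_add_cancel] at h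
    rw [← h]
    by_contra hne
    have : (0 : ℤ) ≤ k - 1 := hδ y hne
    omega
  have hstep : ∀ k : ℤ, k ≤ 0 →
      B (halfGeometric hz y) (k + 1) = z • B (halfGeometric hz y) k := fun k hk => by
    have h := congrArg (fun u : WeightedL2 H ρ => u k) (hcomm (halfGeometric hz y))
    simp only [frontShift_halfGeometric, map_sub, map_smul, sub_apply, smul_apply, hδ0 k hk,
      smul_zero, sub_zero] at h
    exact h.symm
  induction j with
  | zero => simpa using hstep 0 le_rfl
  | succ j ih =>
    have h := hstep (1 - ((j + 1 : ℕ) : ℤ)) (by push_cast; omega)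
    have e : 1 - ((j + 1 : ℕ) : ℤ) + 1 = 1 - (j : ℤ) := by push_cast; ring
    rw [e, ih] at h
    rw [← smul_right_injective H hz0 |>.eq_iff, ← h, smul_smul, ← e, zpow_add_one₀ hz0, mul_comm]

theorem norm_resolventMap_apply_le (h1 : 1 < ρ) (hB : IsInverse (fracOp α A) B)
    (hδ : ∀ x : H, Function.support (B (delta (-1) x)) ⊆ Set.Ici (0 : ℤ)) (hz : ρ < ‖z‖) (y : H) :
    ‖resolventMap B hz y‖ ≤ ‖B‖ * ‖y‖ := by
  obtain ⟨c, hc, hnorm⟩ := exists_norm_halfGeometric (H := H) hz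
  have hle : ‖halfGeometric hz (resolventMap B hz y)‖ ≤ ‖B (halfGeometric hz y)‖ := by
    refine norm_le_norm_of_forall_le fun k => ?_
    rw [halfGeometric_apply]
    split_ifs with hk
    · have h := inverse_halfGeometric_apply h1 hB hδ hz y (1 - k).toNat
      rw [Int.toNat_of_nonneg (by omega), sub_sub_cancel] at h
      rw [h, resolventMap_apply]
    · simp
  have hle' := hle.trans (B.le_opNorm _)
  rw [hnorm, hnorm, mul_left_comm] at hle'
  exact le_of_mul_le_mul_left hle' hc

theorem symbol_sub_apply_resolventMap (h1 : 1 < ρ) (hB : IsInverse (fracOp α A) B)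
    (hδ : ∀ x : H, Function.support (B (delta (-1) x)) ⊆ Set.Ici (0 : ℤ)) (hz : ρ < ‖z‖) (y : H) :
    symbol α z • resolventMap B hz y - A (resolventMap B hz y) = y := by
  have hT : fracOp α A (B (halfGeometric hz y)) = halfGeometric hz y :=
    DFunLike.congr_fun hB.1 _
  have h := congrArg (fun u : WeightedL2 H ρ => u 0) hT
  have hsum := hasSum_fracPow_apply h1 α (B (halfGeometric hz y)) 1
  have hsymb := (hasSum_symbol α (h1.trans hz)).smul_const (B (halfGeometric hz y) 0)
  have hF : fracPow H ρ α (B (halfGeometric hz y)) 1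
      = symbol α z • B (halfGeometric hz y) 0 := by
    refine hsum.unique (hsymb.congr_fun fun k => ?_)
    rw [inverse_halfGeometric_apply h1 hB hδ, smul_smul]
  simp only [fracOp_apply, zero_add, hF, halfGeometric_apply, le_refl, if_true, zpow_zero,
    one_smul] at h
  exact h

theorem resolventMap_map (h1 : 1 < ρ) (hB : IsInverse (fracOp α A) B) (hz : ρ < ‖z‖) (y : H) :
    resolventMap B hz (A y) = A (resolventMap B hz y) := by
  have h : halfGeometric hz (A y) = pointwise (ρ := ρ) A (halfGeometric hz y) := by
    ext k
    simp only [halfGeometric_apply, pointwise_apply]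
    split_ifs <;> simp
  rw [resolventMap_apply, h]
  exact congrArg (fun u : WeightedL2 H ρ => u 0)
    (DFunLike.congr_fun (hB.commute (commute_fracOp_pointwise h1 α A)).eq (halfGeometric hz y))

/-- For `ρ < |z|` the operator `f(z) - A` has an inverse of norm at most `‖B‖`. -/
theorem exists_resolvent (h1 : 1 < ρ) (hB : IsInverse (fracOp α A) B)
    (hδ : ∀ x : H, Function.support (B (delta (-1) x)) ⊆ Set.Ici (0 : ℤ)) (hz : ρ < ‖z‖) :
    ∃ R : H →L[ℂ] H, ‖R‖ ≤ ‖B‖ ∧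
      (algebraMap ℂ (H →L[ℂ] H) (symbol α z) - A) * R = 1 ∧
      R * (algebraMap ℂ (H →L[ℂ] H) (symbol α z) - A) = 1 := by
  refine ⟨(resolventMap B hz).mkContinuous ‖B‖ (norm_resolventMap_apply_le h1 hB hδ hz),
    LinearMap.mkContinuous_norm_le _ (norm_nonneg _) _, ?_, ?_⟩
  · ext y
    exact symbol_sub_apply_resolventMap h1 hB hδ hz y
  · ext y
    change resolventMap B hz (symbol α z • y - A y) = y
    rw [map_sub, map_smul, resolventMap_map h1 hB hz]
    exact symbol_sub_apply_resolventMap h1 hB hδ hz y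

theorem symbol_notMem_spectrum (h1 : 1 < ρ) (hB : IsInverse (fracOp α A) B)
    (hδ : ∀ x : H, Function.support (B (delta (-1) x)) ⊆ Set.Ici (0 : ℤ)) (hz : ρ ≤ ‖z‖) :
    symbol α z ∉ spectrum ℂ A := by
  have hz1 : 1 < ‖z‖ := h1.trans_le hz
  -- Points `t z` with `t > 1` lie where the resolvent is bounded by `‖B‖`; choose one so close
  -- to `z` that the perturbation from `f(t z)` to `f(z)` is less than `1 / ‖B‖`.
  have hcont : Filter.Tendsto (fun t : ℝ => ‖symbol α z - symbol α (t * z)‖ * ‖B‖)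
      (nhdsWithin 1 (Set.Ioi 1)) (nhds 0) := by
    have hlin : ContinuousAt (fun t : ℝ => (t : ℂ) * z) 1 := by fun_prop
    have hf : ContinuousAt (fun t : ℝ => symbol α (t * z)) 1 :=
      ContinuousAt.comp (g := symbol α) (by simpa using continuousAt_symbol α hz1) hlin
    have h : ContinuousAt (fun t : ℝ => ‖symbol α z - symbol α (t * z)‖ * ‖B‖) 1 :=
      (continuousAt_const.sub hf).norm.mul continuousAt_const
    have h2 := h.tendsto
    simp only [Complex.ofReal_one, one_mul, sub_self, norm_zero, zero_mul] at h2
    exact h2.mono_left nhdsWithin_le_nhds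
  obtain ⟨t, htlt, ht⟩ :=
    ((hcont.eventually_lt_const zero_lt_one).and self_mem_nhdsWithin).exists
  have ht1 : (1 : ℝ) < t := ht
  have htz : ρ < ‖(t : ℂ) * z‖ := by
    rw [norm_mul, Complex.norm_real, Real.norm_of_nonneg (by linarith)]
    nlinarith
  obtain ⟨R, hR, hR1, hR2⟩ := exists_resolvent h1 hB hδ htz
  rw [spectrum.notMem_iff]
  set d : ℂ := symbol α (t * z) - symbol α z with hd
  have hsmall : ‖d • R‖ < 1 := by
    refine lt_of_le_of_lt (norm_smul_le _ _) (lt_of_le_of_lt ?_ htlt)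
    rw [hd, norm_sub_rev]
    exact mul_le_mul_of_nonneg_left hR (norm_nonneg _)
  have hu := isUnit_one_sub_of_norm_lt_one hsmall
  have hunit : IsUnit (algebraMap ℂ (H →L[ℂ] H) (symbol α (t * z)) - A) :=
    ⟨⟨_, R, hR1, hR2⟩, rfl⟩
  have hfac : algebraMap ℂ (H →L[ℂ] H) (symbol α z) - A
      = (algebraMap ℂ (H →L[ℂ] H) (symbol α (t * z)) - A) * (1 - d • R) := by
    rw [mul_sub, mul_one, mul_smul_comm, hR1, ← Algebra.algebraMap_eq_smul_one, hd, map_sub]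
    abel
  rw [hfac]
  exact hunit.mul hu

end Resolvent

/-! ### The algebra of causal operators and Gelfand theory -/

variable (H ρ) in
/-- The causal bounded operators. -/
def causalSubalgebra : Subalgebra ℂ (WeightedL2 H ρ →L[ℂ] WeightedL2 H ρ) where
  carrier := {B | IsCausal (B : WeightedL2 H ρ →ₗ[ℂ] WeightedL2 H ρ)}
  mul_mem' {_ C} hB hC a f hf := hB a (C f) (hC a f hf)
  add_mem' {B C} hB hC a f hf :=
    (Function.support_add (B f) (C f)).trans (Set.union_subset (hB a f hf) (hC a f hf))
  algebraMap_mem' c _ f hf := (Function.support_const_smul_subset c f).trans hf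

theorem mem_causalSubalgebra_iff {B : WeightedL2 H ρ →L[ℂ] WeightedL2 H ρ} :
    B ∈ causalSubalgebra H ρ ↔ IsCausal (B : WeightedL2 H ρ →ₗ[ℂ] WeightedL2 H ρ) := Iff.rfl

theorem isClosed_causalSubalgebra :
    IsClosed (causalSubalgebra H ρ : Set (WeightedL2 H ρ →L[ℂ] WeightedL2 H ρ)) := by
  have h : (causalSubalgebra H ρ : Set (WeightedL2 H ρ →L[ℂ] WeightedL2 H ρ))
      = ⋂ (a : ℤ) (f : WeightedL2 H ρ) (_ : Function.support f ⊆ Set.Ici a) (k : ℤ) (_ : k < a),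
        {B : WeightedL2 H ρ →L[ℂ] WeightedL2 H ρ | eval k (B f) = 0} := by
    ext B
    simp only [Set.mem_iInter, Set.mem_ofPred_eq, SetLike.mem_coe, mem_causalSubalgebra_iff]
    refine forall₃_congr fun a f _ => ⟨fun h k hk => ?_, fun h k hk => ?_⟩
    · by_contra hne
      exact absurd (h hne) (not_le.2 hk)
    · by_contra hlt
      exact hk (h k (not_le.1 hlt))
  rw [h]
  refine isClosed_iInter fun a => isClosed_iInter fun f => isClosed_iInter fun _ =>
    isClosed_iInter fun k => isClosed_iInter fun _ => isClosed_eq ?_ continuous_const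
  exact (eval k).continuous.comp (ContinuousLinearMap.apply ℂ (WeightedL2 H ρ) f).continuous

theorem pointwise_mem_causalSubalgebra (A : H →L[ℂ] H) :
    pointwise A ∈ causalSubalgebra H ρ := fun a f hf k hk => by
  refine hf fun h0 => hk ?_
  change A (f k) = 0
  rw [h0, map_zero]

theorem backShift_mem_causalSubalgebra : backShift H ρ ∈ causalSubalgebra H ρ :=
  fun a f hf k hk => by
    have : a ≤ k - 1 := hf hk
    change a ≤ k
    omega

variable (ρ) in
/-- The causal operators in the double commutant of `{τ⁻¹, A}`. Passing to the double commutant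
makes the algebra commutative and closed under causal inverses. -/
def bicommutant (A : H →L[ℂ] H) : Subalgebra ℂ (WeightedL2 H ρ →L[ℂ] WeightedL2 H ρ) :=
  Subalgebra.centralizer ℂ (Set.centralizer {backShift H ρ, pointwise A}) ⊓ causalSubalgebra H ρ

section Bicommutant

variable {A : H →L[ℂ] H}

theorem mem_bicommutant_iff {X : WeightedL2 H ρ →L[ℂ] WeightedL2 H ρ} :
    X ∈ bicommutant ρ A ↔ (∀ Y : WeightedL2 H ρ →L[ℂ] WeightedL2 H ρ,
      Commute Y (backShift H ρ) → Commute Y (pointwise A) → Commute Y X) ∧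
      IsCausal (X : WeightedL2 H ρ →ₗ[ℂ] WeightedL2 H ρ) := by
  refine and_congr ?_ Iff.rfl
  refine forall_congr' fun Y => ⟨fun h h1 h2 => h ?_, fun h hY => h ?_ ?_⟩
  · rintro X (rfl | rfl)
    exacts [h1.symm, h2.symm]
  · exact (hY _ (Or.inl rfl)).symm
  · exact (hY _ (Or.inr rfl)).symm

theorem isClosed_bicommutant :
    IsClosed (bicommutant ρ A : Set (WeightedL2 H ρ →L[ℂ] WeightedL2 H ρ)) :=
  IsClosed.inter (Set.isClosed_centralizer _) isClosed_causalSubalgebra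

theorem backShift_mem_bicommutant : backShift H ρ ∈ bicommutant ρ A :=
  mem_bicommutant_iff.2 ⟨fun _ h _ => h, backShift_mem_causalSubalgebra⟩

theorem pointwise_mem_bicommutant : pointwise A ∈ bicommutant ρ A :=
  mem_bicommutant_iff.2 ⟨fun _ _ h => h, pointwise_mem_causalSubalgebra A⟩

theorem bicommutant_mul_comm (X Y : bicommutant ρ A) : X * Y = Y * X := by
  have hX : ∀ Z ∈ ({backShift H ρ, pointwise A} : Set _), 
      Commute (X : WeightedL2 H ρ →L[ℂ] WeightedL2 H ρ) Z := by
    rintro Z (rfl | rfl)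
    · exact ((mem_bicommutant_iff.1 X.2).1 _ (Commute.refl _)
        (commute_backShift_pointwise A)).symm
    · exact ((mem_bicommutant_iff.1 X.2).1 _ (commute_backShift_pointwise A).symm
        (Commute.refl _)).symm
  exact Subtype.ext ((mem_bicommutant_iff.1 Y.2).1 _ (hX _ (Or.inl rfl)) (hX _ (Or.inr rfl)))

/-- The resolvents of `A` act by elements of the bicommutant. -/
theorem pointwise_resolvent_mem_bicommutant {c : ℂ} {R : H →L[ℂ] H}
    (h1 : (algebraMap ℂ (H →L[ℂ] H) c - A) * R = 1)
    (h2 : R * (algebraMap ℂ (H →L[ℂ] H) c - A) = 1) : pointwise R ∈ bicommutant ρ A := by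
  refine mem_bicommutant_iff.2 ⟨fun Y _ hY => ?_, pointwise_mem_causalSubalgebra R⟩
  have hinv : IsInverse (algebraMap ℂ (WeightedL2 H ρ →L[ℂ] WeightedL2 H ρ) c - pointwise A)
      (pointwise R) := by
    constructor
    · ext x k
      exact DFunLike.congr_fun h1 (x k)
    · ext x k
      exact DFunLike.congr_fun h2 (x k)
  exact (hinv.commute ((Algebra.commute_algebraMap_right c Y).sub_right hY).symm).symm

/-- A character of the bicommutant takes `A` to a spectral value of `A`. -/
theorem algHom_pointwise_mem_spectrum (χ : bicommutant ρ A →ₐ[ℂ] ℂ) :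
    χ ⟨pointwise A, pointwise_mem_bicommutant⟩ ∈ spectrum ℂ A := by
  by_contra hmem
  rw [spectrum.notMem_iff] at hmem
  set c := χ ⟨pointwise A, pointwise_mem_bicommutant⟩ with hc
  obtain ⟨⟨_, R, h1, h2⟩, rfl⟩ := hmem
  have hprod : (algebraMap ℂ (bicommutant ρ A) c
      - ⟨pointwise A, pointwise_mem_bicommutant⟩)
      * ⟨pointwise R, pointwise_resolvent_mem_bicommutant h1 h2⟩ = 1 := by
    refine Subtype.ext ?_
    ext x k
    exact DFunLike.congr_fun h1 (x k)
  have h := congrArg χ hprod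
  rw [map_mul, map_sub, AlgHom.commutes, ← hc, Algebra.algebraMap_self_apply, sub_self, zero_mul,
    map_one] at h
  exact zero_ne_one h

end Bicommutant

theorem exists_isInverse_isCausal [CompleteSpace H] (h1 : 1 < ρ) (α : ℂ) (A : H →L[ℂ] H)
    (hA : ∀ z : ℂ, ρ ≤ ‖z‖ → symbol α z ∉ spectrum ℂ A) :
    ∃ B : WeightedL2 H ρ →L[ℂ] WeightedL2 H ρ, IsInverse (fracOp α A) B ∧
      IsCausal (B : WeightedL2 H ρ →ₗ[ℂ] WeightedL2 H ρ) := by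
  have : CompleteSpace (bicommutant ρ A) := isClosed_bicommutant.completeSpace_coe
  let s : bicommutant ρ A := ⟨backShift H ρ, backShift_mem_bicommutant⟩
  let a : bicommutant ρ A := ⟨pointwise A, pointwise_mem_bicommutant⟩
  let U : bicommutant ρ A := onePlusPow α (-s) - s * a
  have hs : ‖-s‖ < 1 := by
    change ‖-backShift H ρ‖ < 1
    rw [norm_neg]
    exact norm_shift_symm_lt_one h1
  have hU : (U : WeightedL2 H ρ →L[ℂ] WeightedL2 H ρ)
      = fracPow H ρ α - backShift H ρ * pointwise A :=
    congrArg (· - backShift H ρ * pointwise A)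
      (map_onePlusPow (bicommutant ρ A).val continuous_subtype_val α hs)
  have hunit : IsUnit U := by
    refine isUnit_of_forall_algHom_ne_zero _ isClosed_bicommutant bicommutant_mul_comm U
      fun χ hχ => ?_
    have hcont : Continuous χ := AddMonoidHomClass.continuous_of_bound χ ‖(1 : bicommutant ρ A)‖
      fun x => (hχ x).trans_eq (mul_comm _ _)
    have hw : ‖χ s‖ ≤ ρ⁻¹ := by
      refine (hχ s).trans ((mul_le_of_le_one_right (norm_nonneg _) ?_).trans norm_backShift_le)
      exact ContinuousLinearMap.norm_id_le
    have hval : χ U = onePlusPow α (-χ s) - χ s * χ a := by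
      rw [map_sub, map_mul, map_onePlusPow χ hcont α hs, map_neg]
    rw [hval]
    rcases eq_or_ne (χ s) 0 with h0 | h0
    · rw [h0, onePlusPow_eq_cpow α (by simp)]
      simp
    · intro hzero
      refine hA (χ s)⁻¹ ?_ ?_
      · rw [norm_inv]
        exact (le_inv_comm₀ (norm_pos_iff.2 h0) hρ.out).1 hw
      · have : symbol α (χ s)⁻¹ = χ a := by
          rw [symbol, inv_inv, sub_eq_zero.1 hzero, inv_mul_cancel_left₀ h0]
        rw [this]
        exact algHom_pointwise_mem_spectrum χ
  obtain ⟨⟨U', V, hV1, hV2⟩, hUU⟩ := hunit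
  obtain rfl : U' = U := hUU
  have hV1' : (U : WeightedL2 H ρ →L[ℂ] WeightedL2 H ρ) * V = 1 := congrArg Subtype.val hV1
  have hV2' : (V : WeightedL2 H ρ →L[ℂ] WeightedL2 H ρ) * U = 1 := congrArg Subtype.val hV2
  have hT : fracOp α A = frontShift H ρ * (U : WeightedL2 H ρ →L[ℂ] WeightedL2 H ρ) := by
    rw [hU, mul_sub, ← mul_assoc, frontShift_mul_backShift, one_mul]
    rfl
  refine ⟨V * backShift H ρ, ⟨?_, ?_⟩, ?_⟩
  · rw [hT, mul_assoc, ← mul_assoc (U : WeightedL2 H ρ →L[ℂ] WeightedL2 H ρ), hV1', one_mul,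
      frontShift_mul_backShift]
  · rw [hT, mul_assoc, ← mul_assoc (backShift H ρ), backShift_mul_frontShift, one_mul, hV2']
  · exact (causalSubalgebra H ρ).mul_mem (mem_bicommutant_iff.1 V.2).2
      backShift_mem_causalSubalgebra

end WeightedL2

end FracDiff

end

theorem mainTheorem1 {H : Type*} [NormedAddCommGroup H] [InnerProductSpace ℂ H] [CompleteSpace H]
    [TopologicalSpace.SeparableSpace H] (ρ : ℝ) [Fact (0 < ρ)] (hρ : 1 < ρ)
    (α : ℝ) (hα₀ : 0 < α) (hα₁ : α < 1) (A : H →L[ℂ] H) :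
    List.TFAE [
      ∃ B : FracDiff.WeightedL2 H ρ →L[ℂ] FracDiff.WeightedL2 H ρ,
        FracDiff.WeightedL2.IsInverse (FracDiff.WeightedL2.fracOp (α : ℂ) A) B ∧
        FracDiff.WeightedL2.IsCausal (B : FracDiff.WeightedL2 H ρ →ₗ[ℂ] FracDiff.WeightedL2 H ρ),
      ∃ B : FracDiff.WeightedL2 H ρ →L[ℂ] FracDiff.WeightedL2 H ρ,
        FracDiff.WeightedL2.IsInverse (FracDiff.WeightedL2.fracOp (α : ℂ) A) B ∧
        ∀ x : H, Function.support (B (FracDiff.WeightedL2.delta (-1) x)) ⊆ Set.Ici (0 : ℤ),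
      ∀ μ : ℝ, ρ ≤ μ →
        FracDiff.symbol (α : ℂ) '' Metric.sphere (0 : ℂ) μ ∩ spectrum ℂ A = ∅] := by
  tfae_have 1 → 2 := fun ⟨B, hB, hc⟩ =>
    ⟨B, hB, FracDiff.WeightedL2.support_delta_subset_of_isCausal hρ α hB hc⟩
  tfae_have 2 → 3 := by
    rintro ⟨B, hB, hδ⟩ μ hμ
    refine Set.eq_empty_of_forall_notMem ?_
    rintro _ ⟨⟨z, hz, rfl⟩, hmem⟩
    exact FracDiff.WeightedL2.symbol_notMem_spectrum hρ hB hδ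
      (hμ.trans_eq (mem_sphere_zero_iff_norm.1 hz).symm) hmem
  tfae_have 3 → 1 := fun h =>
    FracDiff.WeightedL2.exists_isInverse_isCausal hρ α A fun z hz hmem =>
      (h ‖z‖ hz).le ⟨⟨z, mem_sphere_zero_iff_norm.2 rfl, rfl⟩, hmem⟩
  tfae_finish
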